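/- Let $\mathbb{A}=((0,1]\times\{0\})\cup([0,1)\times\{1\})$ be the Alexandroff--Urysohn double arrow space, ordered lexicographically ($\langle x,t\rangle<\langle y,s\rangle$ iff $x<y$, or $x=y$ and $t<s$) and equipped with the order topology. A separable space $X$ is called countable dense homogeneous (CDH) if for all countable dense subsets $D,E\subseteq X$ there is a homeomorphism $h:X\to X$ with $h[D]=E$. Proposition. For every integer $n\geq 1$, the finite power $\mathbb{A}^n$ (with the product topology) is not CDH. More precisely, let $D=(\mathbb{Q}\cap(0,1))\times\{0\}$ and $E=(\mathbb{Q}\cap(0,1))\times\{0,1\}$. Then $D^n$ and $E^n$ are countable dense subsets of $\mathbb{A}^n$, and there is no homeomorphism $h:\mathbb{A}^n\to\mathbb{A}^n$ with $h[E^n]=D^n$. -/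

import Mathlib

/-- A space `X` is countable dense homogeneous if it is separable and any two countable dense
subsets of `X` are mapped onto each other by a self-homeomorphism of `X`. -/
def IsCDH (X : Type*) [TopologicalSpace X] : Prop :=
  TopologicalSpace.SeparableSpace X ∧
    ∀ D E : Set X, D.Countable → Dense D → E.Countable → Dense E →
      ∃ h : X ≃ₜ X, h '' D = E

/-- The underlying set `((0,1] × {0}) ∪ ([0,1) × {1})` of the Alexandroff-Urysohn double arrow
space. -/
@[ext]
structure DoubleArrow : Type where
  /-- The first coordinate `x` of the point `⟨x, t⟩`. -/
  fst : ℝ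
  /-- The second coordinate `t` of the point `⟨x, t⟩`. -/
  snd : Fin 2
  mem : fst ∈ Set.Ioc (0 : ℝ) 1 ∧ snd = 0 ∨ fst ∈ Set.Ico (0 : ℝ) 1 ∧ snd = 1

namespace DoubleArrow

/-- The inclusion into `ℝ × {0,1}` with the lexicographic order. -/
def toProdLex (a : DoubleArrow) : ℝ ×ₗ Fin 2 := toLex (a.fst, a.snd)

theorem toProdLex_injective : Function.Injective toProdLex := by
  intro a b h
  have h2 : (a.fst, a.snd) = (b.fst, b.snd) := toLex.injective h
  exact DoubleArrow.ext (congrArg Prod.fst h2) (congrArg Prod.snd h2)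

/-- The lexicographic order. -/
noncomputable instance instLinearOrder : LinearOrder DoubleArrow :=
  LinearOrder.lift' toProdLex toProdLex_injective

theorem lt_iff (a b : DoubleArrow) :
    a < b ↔ a.fst < b.fst ∨ a.fst = b.fst ∧ a.snd < b.snd :=
  Prod.Lex.lt_iff

/-- The order topology of the lexicographic order on the double arrow space itself. -/
noncomputable instance instTopologicalSpace : TopologicalSpace DoubleArrow :=
  Preorder.topology DoubleArrow

instance instOrderTopology : OrderTopology DoubleArrow := ⟨rfl⟩

/-- The set `(ℚ ∩ (0,1)) × {0}`. -/
def ratLower : Set DoubleArrow :=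
  {a | (∃ q : ℚ, (q : ℝ) = a.fst) ∧ a.fst ∈ Set.Ioo (0 : ℝ) 1 ∧ a.snd = 0}

/-- The set `(ℚ ∩ (0,1)) × {0,1}`. -/
def ratBoth : Set DoubleArrow :=
  {a | (∃ q : ℚ, (q : ℝ) = a.fst) ∧ a.fst ∈ Set.Ioo (0 : ℝ) 1}

end DoubleArrow

/-!
A cut of a subset `W` of a power of a linear order, along the coordinate `j`, is a point `p` for
which `W` separates some point `x` with `x j = p` from a point obtained by replacing `x j` with the
immediate successor of `p`. If the order is compact in its order topology, a clopen `W` has only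
finitely many cuts (`IsClopen.finite_cutSet`): along an ultrafilter of infinitely many cuts, both
points of the separated pairs would converge to the same limit.

Write `𝔸` for the double arrow space, `D` for `ratLower` and `E` for `ratBoth`, and suppose that a
self-homeomorphism `h` of `𝔸ⁿ` maps `Eⁿ` onto `Dⁿ`. Fix a coordinate `j`. For `t ∈ (0, 1)` the sets
`{x | h x i ≤ ⟨t, 0⟩}` are clopen, so their cuts along `j` among the points `⟨q, 0⟩` with `q`
rational form a finite subset of a countable set. By the Baire category theorem there are a single finite set `F`
and an interval `(a, b)` in which the parameters `t` whose rational cuts all lie in `F` are dense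
(`exists_finset_Ioo_subset_closure`). The preimage under `h` of the box of points with all
coordinates over `(a, b)` is open and nonempty, so it contains two points `e ≠ e'` of `Eⁿ`
that agree off the coordinate `j`, where they are `⟨q, 0⟩` and `⟨q, 1⟩` with
`⟨q, 0⟩ ∉ F`. Now `h e` and `h e'` are distinct points of `Dⁿ`, so in some coordinate `i` they lie
over distinct reals in `(a, b)`. Some `t` as above lies between those reals, and then `⟨q, 0⟩`
is a cut of `{x | h x i ≤ ⟨t, 0⟩}` outside `F`, a contradiction.
-/

open Set Filter Topology

/-! ### Cuts of clopen sets -/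

/-- The points `p` such that `W` separates two points that agree off the coordinate `j`, where
the first has the value `p` and the second has a value covering `p`. -/
def cutSet {ι α : Type*} [Preorder α] (W : Set (ι → α)) (j : ι) : Set α :=
  {p | ∃ x y : ι → α, x j = p ∧ p ⋖ y j ∧ (∀ i, i ≠ j → x i = y i) ∧ ¬(x ∈ W ↔ y ∈ W)}

theorem IsClopen.finite_cutSet {ι α : Type*} [LinearOrder α] [TopologicalSpace α]
    [OrderTopology α] [CompactSpace α] {W : Set (ι → α)} (hW : IsClopen W) (j : ι) :
    (cutSet W j).Finite := by
  by_contra hinf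
  have : Infinite (cutSet W j) := Set.infinite_coe_iff.2 hinf
  have hmem (p : cutSet W j) : ∃ x y : ι → α, x j = p ∧ (p : α) ⋖ y j ∧
      (∀ i, i ≠ j → x i = y i) ∧ ¬(x ∈ W ↔ y ∈ W) := p.2
  choose x y hx hy hxy hsep using hmem
  let 𝓤 : Ultrafilter (cutSet W j) := hyperfilter _
  obtain ⟨a, -, ha⟩ := isCompact_univ.ultrafilter_le_nhds (𝓤.map x) (by simp)
  obtain ⟨b, -, hb⟩ := isCompact_univ.ultrafilter_le_nhds (𝓤.map y) (by simp)
  have hxa : Tendsto x 𝓤 (𝓝 a) := ha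
  have hyb : Tendsto y 𝓤 (𝓝 b) := hb
  rw [tendsto_pi_nhds] at hxa hyb
  have hab : a = b := by
    funext i
    by_cases hi : i = j
    · subst hi
      have hle : a i ≤ b i :=
        le_of_tendsto_of_tendsto' (hxa i) (hyb i) fun p => (hx p).trans_le (hy p).le
      refine hle.eq_of_not_lt fun hlt => ?_
      have hx_lt : ∀ᶠ p in 𝓤, x p i < b i := (hxa i).eventually_lt_const hlt
      have hy_gt : ∀ᶠ p in 𝓤, a i < y p i := (hyb i).eventually_const_lt hlt
      by_cases hc : ∃ c, a i < c ∧ c < b i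
      · obtain ⟨c, hac, hcb⟩ := hc
        obtain ⟨p, hp1, hp2⟩ := (((hxa i).eventually_lt_const hac).and
          ((hyb i).eventually_const_lt hcb)).exists
        exact (hy p).2 (hx p ▸ hp1) hp2
      · -- `b i` covers `a i`, so eventually `p = a i`, although the ultrafilter is not principal.
        have hconst : ∀ᶠ p : cutSet W i in 𝓤, (p : α) = a i := by
          filter_upwards [hx_lt, hy_gt] with p hp1 hp2
          have h1 : (p : α) ≤ a i := by
            by_contra! h
            exact hc ⟨p, h, hx p ▸ hp1⟩
          have h2 : a i ≤ p := by
            by_contra! h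
            exact (hy p).2 h hp2
          exact le_antisymm h1 h2
        have hfin : {p : cutSet W i | (p : α) = a i}.Finite :=
          Set.Subsingleton.finite fun p hp q hq => Subtype.ext (hp.trans hq.symm)
        exact hfin.notMem_hyperfilter hconst
    · refine tendsto_nhds_unique (hxa i) ?_
      simpa only [hxy _ i hi] using hyb i
  subst hab
  have hsame : ∀ᶠ p in 𝓤, (x p ∈ W ↔ y p ∈ W) := by
    by_cases haW : a ∈ W
    · filter_upwards [ha (hW.isOpen.mem_nhds haW), hb (hW.isOpen.mem_nhds haW)] with p h1 h2
      exact iff_of_true h1 h2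
    · filter_upwards [ha (hW.compl.isOpen.mem_nhds haW), hb (hW.compl.isOpen.mem_nhds haW)]
        with p h1 h2
      exact iff_of_false h1 h2
  obtain ⟨p, hp⟩ := hsame.exists
  exact hsep p hp

/-! ### Order and compactness of the double arrow space -/

theorem compactSpace_of_exists_isLUB {α : Type*} [LinearOrder α] [TopologicalSpace α]
    [OrderTopology α] (hsup : ∀ s : Set α, ∃ b, IsLUB s b) : CompactSpace α := by
  obtain ⟨top, htop⟩ := hsup univ
  obtain ⟨bot, hbot⟩ := hsup ∅
  choose S hS using hsup
  have hba (s : Set α) : BddAbove s := ⟨top, fun x _ => htop.1 (mem_univ x)⟩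
  have hbb (s : Set α) : BddBelow s := ⟨bot, fun x _ => hbot.2 (by simp)⟩
  let _ : SupSet α := ⟨S⟩
  let _ : ConditionallyCompleteLinearOrder α :=
    { ‹LinearOrder α›, conditionallyCompleteLatticeOfsSup α (fun _ _ => hba _) (fun _ _ => hbb _)
        (fun s _ _ => hS s) with
      csSup_of_not_bddAbove := fun s h => absurd (hba s) h
      csInf_of_not_bddBelow := fun s h => absurd (hbb s) h }
  have huniv : (univ : Set α) = Icc bot top :=
    Subset.antisymm (fun x _ => mem_Icc.2 ⟨hbot.2 (by simp), htop.1 (mem_univ x)⟩)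
      (subset_univ _)
  exact ⟨by rw [huniv]; exact isCompact_Icc⟩

namespace DoubleArrow

/-- The point `⟨r, 0⟩`. -/
def lower (r : ℝ) (hr : r ∈ Ioc (0 : ℝ) 1) : DoubleArrow := ⟨r, 0, Or.inl ⟨hr, rfl⟩⟩

/-- The point `⟨r, 1⟩`. -/
def upper (r : ℝ) (hr : r ∈ Ico (0 : ℝ) 1) : DoubleArrow := ⟨r, 1, Or.inr ⟨hr, rfl⟩⟩

theorem fst_mem_Icc (a : DoubleArrow) : a.fst ∈ Icc (0 : ℝ) 1 := by
  rcases a.mem with ⟨h, -⟩ | ⟨h, -⟩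
  exacts [Ioc_subset_Icc_self h, Ico_subset_Icc_self h]

theorem eq_lower_or_eq_upper (a : DoubleArrow) :
    (∃ h, a = lower a.fst h) ∨ ∃ h, a = upper a.fst h := by
  rcases a.mem with ⟨h, h'⟩ | ⟨h, h'⟩
  · exact Or.inl ⟨h, DoubleArrow.ext rfl h'⟩
  · exact Or.inr ⟨h, DoubleArrow.ext rfl h'⟩

theorem fst_le_of_le {a b : DoubleArrow} (h : a ≤ b) : a.fst ≤ b.fst := by
  by_contra! hlt
  exact h.not_gt ((lt_iff b a).2 (Or.inl hlt))

theorem lt_lower_iff {a : DoubleArrow} {r : ℝ} {hr : r ∈ Ioc (0 : ℝ) 1} :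
    a < lower r hr ↔ a.fst < r := by
  simp [lt_iff, lower]

theorem upper_lt_iff {a : DoubleArrow} {r : ℝ} {hr : r ∈ Ico (0 : ℝ) 1} :
    upper r hr < a ↔ r < a.fst := by
  have : ¬ (1 : Fin 2) < a.snd := by have := a.snd.isLt; omega
  simp [lt_iff, upper, this]

theorem lower_covBy_upper {r : ℝ} (h : r ∈ Ioc (0 : ℝ) 1) (h' : r ∈ Ico (0 : ℝ) 1) :
    lower r h ⋖ upper r h' := by
  refine ⟨(lt_iff _ _).2 (Or.inr ⟨rfl, Fin.zero_lt_one⟩), fun c hc hc' => ?_⟩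
  rcases eq_lower_or_eq_upper c with ⟨hm, hl⟩ | ⟨hm, hu⟩
  · rw [hl, lt_iff] at hc hc'
    simp only [lower, upper, lt_irrefl, and_false, or_false] at hc hc'
    rcases hc' with h1 | ⟨h1, -⟩
    · exact hc.not_gt h1
    · exact hc.ne' h1
  · rw [hu, lt_iff] at hc hc'
    simp only [lower, upper, lt_irrefl, and_false, or_false] at hc hc'
    rcases hc with h1 | ⟨h1, -⟩
    · exact hc'.not_gt h1
    · exact hc'.ne' h1

theorem exists_isLUB (s : Set DoubleArrow) : ∃ b, IsLUB s b := by
  rcases s.eq_empty_or_nonempty with rfl | hs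
  · refine ⟨upper 0 (by simp), ?_⟩
    rw [isLUB_empty_iff]
    exact fun a => not_lt.1 fun h => (fst_mem_Icc a).1.not_gt <| by
      rcases (lt_iff _ _).1 h with h | ⟨h, h'⟩
      · exact h
      · rcases a.mem with ⟨h1, -⟩ | ⟨-, h1⟩
        · exact absurd h h1.1.ne'
        · simp [upper, h1] at h'
  have hlub : IsLUB (fst '' s) (sSup (fst '' s)) :=
    isLUB_csSup (hs.image _) ⟨1, by rintro _ ⟨a, -, rfl⟩; exact (fst_mem_Icc a).2⟩
  set r := sSup (fst '' s)
  have hle (a : DoubleArrow) (ha : a ∈ s) : a.fst ≤ r := hlub.1 ⟨a, ha, rfl⟩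
  have hr1 : r ≤ 1 := hlub.2 (by rintro _ ⟨a, -, rfl⟩; exact (fst_mem_Icc a).2)
  by_cases hmax : ∃ h, upper r h ∈ s
  · obtain ⟨h, hm⟩ := hmax
    exact ⟨_, IsGreatest.isLUB ⟨hm, fun a ha => not_lt.1 fun hlt =>
      (hle a ha).not_gt (upper_lt_iff.1 hlt)⟩⟩
  · have hr0 : 0 < r := by
      obtain ⟨a, ha⟩ := hs
      rcases eq_lower_or_eq_upper a with ⟨h, -⟩ | ⟨h, heq⟩
      · exact h.1.trans_le (hle a ha)
      · refine h.1.trans_lt ((hle a ha).lt_of_ne fun he => hmax ⟨he ▸ h, ?_⟩)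
        exact mem_of_eq_of_mem (DoubleArrow.ext he.symm (congrArg snd heq).symm) ha
    refine ⟨lower r ⟨hr0, hr1⟩, fun a ha => ?_, fun b hb => not_lt.1 fun hlt => ?_⟩
    · rcases (hle a ha).lt_or_eq with h | h
      · exact (lt_lower_iff.2 h).le
      · rcases eq_lower_or_eq_upper a with ⟨h', heq⟩ | ⟨h', heq⟩
        · rw [heq]; exact le_of_eq (by simp [lower, h])
        · refine absurd ⟨h ▸ h', ?_⟩ hmax
          exact mem_of_eq_of_mem (DoubleArrow.ext h.symm (congrArg snd heq).symm) ha
    · refine (lt_lower_iff.1 hlt).not_ge (hlub.2 ?_)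
      rintro _ ⟨a, ha, rfl⟩
      exact fst_le_of_le (hb ha)

instance instCompactSpace : CompactSpace DoubleArrow :=
  compactSpace_of_exists_isLUB exists_isLUB

/-! ### Open sets and the two countable dense sets -/

/-- Every nonempty open set contains all points lying over some open interval of reals. -/
theorem exists_Ioo_subset_of_isOpen {U : Set DoubleArrow} (hU : IsOpen U) (hne : U.Nonempty) :
    ∃ c d : ℝ, c < d ∧ Ioo c d ⊆ Ioo 0 1 ∧ ∀ p : DoubleArrow, p.fst ∈ Ioo c d → p ∈ U := by
  obtain ⟨a, ha⟩ := hne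
  rcases eq_lower_or_eq_upper a with ⟨h, heq⟩ | ⟨h, heq⟩
  · obtain ⟨l, hl, hsub⟩ := exists_Ioc_subset_of_mem_nhds (hU.mem_nhds ha)
      ⟨upper 0 (by simp), by rw [upper_lt_iff]; exact h.1⟩
    refine ⟨l.fst, a.fst, ?_, Ioo_subset_Ioo (fst_mem_Icc l).1 (fst_mem_Icc a).2, fun p hp =>
      hsub ⟨(lt_iff _ _).2 (Or.inl hp.1), ((lt_iff _ _).2 (Or.inl hp.2)).le⟩⟩
    rw [heq] at hl
    exact lt_lower_iff.1 hl
  · obtain ⟨l, hl, hsub⟩ := exists_Ico_subset_of_mem_nhds (hU.mem_nhds ha)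
      ⟨lower 1 (by simp), by rw [lt_lower_iff]; exact h.2⟩
    refine ⟨a.fst, l.fst, ?_, Ioo_subset_Ioo (fst_mem_Icc a).1 (fst_mem_Icc l).2, fun p hp =>
      hsub ⟨((lt_iff _ _).2 (Or.inl hp.1)).le, (lt_iff _ _).2 (Or.inl hp.2)⟩⟩
    rw [heq] at hl
    exact upper_lt_iff.1 hl

theorem isClopen_Iic_lower (t : ℝ) (ht : t ∈ Ioo (0 : ℝ) 1) :
    IsClopen (Iic (lower t (Ioo_subset_Ioc_self ht))) := by
  refine ⟨isClosed_Iic, ?_⟩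
  rw [← (lower_covBy_upper (Ioo_subset_Ioc_self ht) (Ioo_subset_Ico_self ht)).Iio_eq]
  exact isOpen_Iio

theorem ratLower_subset_ratBoth : ratLower ⊆ ratBoth := fun _ h => ⟨h.1, h.2.1⟩

theorem countable_ratBoth : ratBoth.Countable := by
  refine ((countable_range ((↑) : ℚ → ℝ)).prod (countable_univ (α := Fin 2))).preimage_of_injOn
    (f := fun a : DoubleArrow => (a.fst, a.snd)) ?_ |>.mono ?_
  · intro a _ b _ h
    exact toProdLex_injective h
  · exact fun a ha => ⟨ha.1, mem_univ _⟩

theorem dense_ratLower : Dense ratLower := by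
  refine dense_iff_inter_open.2 fun U hU hne => ?_
  obtain ⟨c, d, hcd, hsub, hmem⟩ := exists_Ioo_subset_of_isOpen hU hne
  obtain ⟨q, hq⟩ := exists_rat_btwn hcd
  exact ⟨lower q (Ioo_subset_Ioc_self (hsub hq)), hmem _ hq, ⟨q, rfl⟩, hsub hq, rfl⟩

theorem dense_ratBoth : Dense ratBoth := dense_ratLower.mono ratLower_subset_ratBoth

theorem fst_injOn_ratLower : InjOn fst ratLower :=
  fun _ ha _ hb h => DoubleArrow.ext h (ha.2.2.trans hb.2.2.symm)

/-! ### The two dense sets are not equivalent -/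

/-- Given a continuous self-map `f` of a power, there is one finite set that contains all rational
cuts of `{x | f x i ≤ ⟨t, 0⟩}` for a set of parameters `t` dense in some interval. -/
theorem exists_finset_Ioo_subset_closure {ι : Type*} [Finite ι]
    {f : (ι → DoubleArrow) → ι → DoubleArrow} (hf : Continuous f) (j : ι) :
    ∃ (F : Finset ratLower) (a b : ℝ), a < b ∧ Ioo a b ⊆ Ioo 0 1 ∧
      Ioo a b ⊆ closure {t | ∀ (ht : t ∈ Ioo (0 : ℝ) 1) (i : ι), ∀ p : ratLower,
        (p : DoubleArrow) ∈ cutSet {x | f x i ≤ lower t (Ioo_subset_Ioc_self ht)} j → p ∈ F} := by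
  set T : Finset ratLower → Set ℝ := fun F => {t | ∀ (ht : t ∈ Ioo (0 : ℝ) 1) (i : ι),
    ∀ p : ratLower,
      (p : DoubleArrow) ∈ cutSet {x | f x i ≤ lower t (Ioo_subset_Ioc_self ht)} j → p ∈ F}
  have : Countable ratLower := (countable_ratBoth.mono ratLower_subset_ratBoth).to_subtype
  have hcover : ⋃ F, closure (T F) = univ := by
    refine eq_univ_of_forall fun t => ?_
    suffices ∃ F, t ∈ T F from
      let ⟨F, hF⟩ := this
      mem_iUnion.2 ⟨F, subset_closure hF⟩
    by_cases ht : t ∈ Ioo (0 : ℝ) 1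
    · have hfin : {p : ratLower | ∃ i, (p : DoubleArrow) ∈
          cutSet {x | f x i ≤ lower t (Ioo_subset_Ioc_self ht)} j}.Finite := by
        rw [ofPred_exists]
        refine finite_iUnion fun i => Finite.preimage Subtype.val_injective.injOn ?_
        exact ((isClopen_Iic_lower t ht).preimage
          ((continuous_apply i).comp hf)).finite_cutSet j
      exact ⟨hfin.toFinset, fun _ i p hp => hfin.mem_toFinset.2 ⟨i, hp⟩⟩
    · exact ⟨∅, fun ht' => absurd ht' ht⟩
  obtain ⟨t, ht, htF⟩ := (dense_iUnion_interior_of_closed (fun F => isClosed_closure (s := T F))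
    hcover).inter_open_nonempty (Ioo 0 1) isOpen_Ioo (nonempty_Ioo.2 one_pos)
  obtain ⟨F, hF⟩ := mem_iUnion.1 htF
  obtain ⟨a, b, htab, hab⟩ := mem_nhds_iff_exists_Ioo_subset.1
    ((isOpen_interior.inter isOpen_Ioo).mem_nhds ⟨hF, ht⟩)
  exact ⟨F, a, b, htab.1.trans htab.2, fun s hs => (hab hs).2,
    fun s hs => interior_subset (hab hs).1⟩

theorem not_exists_homeomorph_image_pi_ratBoth_eq {ι : Type*} [Finite ι] [Nonempty ι] :
    ¬ ∃ h : (ι → DoubleArrow) ≃ₜ (ι → DoubleArrow),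
      h '' (univ.pi fun _ => ratBoth) = univ.pi fun _ => ratLower := by
  classical
  rintro ⟨h, him⟩
  let j : ι := Classical.arbitrary ι
  obtain ⟨F, a, b, hab, hsub, hT⟩ := exists_finset_Ioo_subset_closure h.continuous j
  have ha0 : 0 ≤ a ∧ b ≤ 1 := (Ioo_subset_Ioo_iff hab).1 hsub
  let G : Set DoubleArrow := Ioo (upper a ⟨ha0.1, hab.trans_le ha0.2⟩)
    (lower b ⟨ha0.1.trans_lt hab, ha0.2⟩)
  have hG {p : DoubleArrow} : p ∈ G ↔ p.fst ∈ Ioo a b :=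
    and_congr upper_lt_iff lt_lower_iff
  have hV : IsOpen (h ⁻¹' univ.pi fun _ => G) :=
    (isOpen_set_pi finite_univ fun _ _ => isOpen_Ioo).preimage h.continuous
  obtain ⟨m, hm⟩ := exists_between hab
  obtain ⟨v, hv⟩ := h.surjective fun _ => lower m (Ioo_subset_Ioc_self (hsub hm))
  obtain ⟨U, hU, hUV⟩ := isOpen_pi_iff'.1 hV v (by
    intro i _
    rw [hv]
    exact hG.2 hm)
  choose c d hcd hsub' hmem using fun i => exists_Ioo_subset_of_isOpen (hU i).1 ⟨v i, (hU i).2⟩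
  -- Rational coordinates over a box in the preimage, the one at `j` avoiding `F`.
  have hdense : Dense (range ((↑) : ℚ → ℝ) \
      (F.image fun p : ratLower => (p : DoubleArrow).fst : Finset ℝ)) :=
    Rat.denseRange_cast.sdiff_finset _
  choose q hq hqm using fun i => hdense.exists_between (hcd i)
  let e : ι → DoubleArrow := fun i => lower (q i) (Ioo_subset_Ioc_self (hsub' i (hqm i)))
  let e' : ι → DoubleArrow :=
    Function.update e j (upper (q j) (Ioo_subset_Ico_self (hsub' j (hqm j))))
  have hfst (i : ι) : (e' i).fst = q i := by
    by_cases hi : i = j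
    · subst hi; simp [e', upper]
    · simp [e', hi, e, lower]
  have heE : e ∈ univ.pi fun _ => ratBoth := fun i _ => ⟨(hq i).1, hsub' i (hqm i)⟩
  have heE' : e' ∈ univ.pi fun _ => ratBoth := fun i _ =>
    ⟨hfst i ▸ (hq i).1, hfst i ▸ hsub' i (hqm i)⟩
  have heV : ∀ i, h e i ∈ G := fun i =>
    hUV (a := e) (fun i _ => hmem i _ (hqm i)) i (mem_univ i)
  have heV' : ∀ i, h e' i ∈ G := fun i =>
    hUV (a := e') (fun i _ => hmem i _ ((hfst i).symm ▸ hqm i)) i (mem_univ i)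
  have heD : ∀ i, h e i ∈ ratLower := fun i =>
    (him ▸ mem_image_of_mem h heE : h e ∈ univ.pi fun _ => ratLower) i (mem_univ i)
  have heD' : ∀ i, h e' i ∈ ratLower := fun i =>
    (him ▸ mem_image_of_mem h heE' : h e' ∈ univ.pi fun _ => ratLower) i (mem_univ i)
  have hcov : e j ⋖ e' j := by
    simpa [e'] using lower_covBy_upper _ _
  have hne : h e ≠ h e' := fun heq => hcov.lt.ne (congrFun (h.injective heq) j)
  obtain ⟨i, hi⟩ := Function.ne_iff.1 hne
  have hfi : (h e i).fst ≠ (h e' i).fst := fun heq =>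
    hi (fst_injOn_ratLower (heD i) (heD' i) heq)
  have hejF : (⟨e j, ⟨(hq j).1, hsub' j (hqm j), rfl⟩⟩ : ratLower) ∉ F := fun hF =>
    (hq j).2 (Finset.mem_coe.2 (Finset.mem_image.2 ⟨_, hF, rfl⟩))
  have hmin := hG.1 (heV i)
  have hmin' := hG.1 (heV' i)
  -- A parameter between the two values of the `i`th coordinate, with all rational cuts in `F`.
  obtain ⟨t, htm, htT⟩ := mem_closure_iff.1
    (hT (show ((h e i).fst + (h e' i).fst) / 2 ∈ Ioo a b from
      ⟨by linarith [hmin.1, hmin'.1], by linarith [hmin.2, hmin'.2]⟩))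
    (Ioo (min (h e i).fst (h e' i).fst) (max (h e i).fst (h e' i).fst)) isOpen_Ioo (by
      rcases hfi.lt_or_gt with hlt | hlt
      · rw [min_eq_left hlt.le, max_eq_right hlt.le]; constructor <;> linarith
      · rw [min_eq_right hlt.le, max_eq_left hlt.le]; constructor <;> linarith)
  have ht01 : t ∈ Ioo (0 : ℝ) 1 :=
    hsub ⟨(lt_min hmin.1 hmin'.1).trans htm.1, htm.2.trans (max_lt hmin.2 hmin'.2)⟩
  refine hejF (htT ht01 i _ ⟨e, e', rfl, hcov, fun k hk => by simp [e', hk], fun hiff => ?_⟩)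
  simp only [mem_ofPred_eq] at hiff
  rcases hfi.lt_or_gt with hlt | hlt
  · rw [min_eq_left hlt.le, max_eq_right hlt.le] at htm
    exact (fst_le_of_le (hiff.1 (lt_lower_iff.2 htm.1).le)).not_gt htm.2
  · rw [min_eq_right hlt.le, max_eq_left hlt.le] at htm
    exact (fst_le_of_le (hiff.2 (lt_lower_iff.2 htm.1).le)).not_gt htm.2

end DoubleArrow

theorem mainTheorem8 (n : ℕ) (hn : 1 ≤ n) :
    ¬ IsCDH (Fin n → DoubleArrow) ∧
    (Set.univ.pi fun _ : Fin n => DoubleArrow.ratLower).Countable ∧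
    Dense (Set.univ.pi fun _ : Fin n => DoubleArrow.ratLower) ∧
    (Set.univ.pi fun _ : Fin n => DoubleArrow.ratBoth).Countable ∧
    Dense (Set.univ.pi fun _ : Fin n => DoubleArrow.ratBoth) ∧
    ¬ ∃ h : (Fin n → DoubleArrow) ≃ₜ (Fin n → DoubleArrow),
      h '' (Set.univ.pi fun _ : Fin n => DoubleArrow.ratBoth) =
        Set.univ.pi fun _ : Fin n => DoubleArrow.ratLower := by
  have : Nonempty (Fin n) := ⟨⟨0, hn⟩⟩
  have hDc : (univ.pi fun _ : Fin n => DoubleArrow.ratLower).Countable :=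
    countable_univ_pi fun _ =>
      DoubleArrow.countable_ratBoth.mono DoubleArrow.ratLower_subset_ratBoth
  have hDd : Dense (univ.pi fun _ : Fin n => DoubleArrow.ratLower) :=
    dense_pi _ fun _ _ => DoubleArrow.dense_ratLower
  have hEc : (univ.pi fun _ : Fin n => DoubleArrow.ratBoth).Countable :=
    countable_univ_pi fun _ => DoubleArrow.countable_ratBoth
  have hEd : Dense (univ.pi fun _ : Fin n => DoubleArrow.ratBoth) :=
    dense_pi _ fun _ _ => DoubleArrow.dense_ratBoth
  have hno := DoubleArrow.not_exists_homeomorph_image_pi_ratBoth_eq (ι := Fin n)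
  exact ⟨fun hcdh => hno (hcdh.2 _ _ hEc hEd hDc hDd), hDc, hDd, hEc, hEd, hno⟩
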